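/- There is an absolute constant $c>0$ such that the following holds for all $n$ and $M$. Let $X\subseteq [M]^n$ be symmetric (if $x\in X$ and $\sigma\in S_n$, then $x_\sigma=(x_{\sigma(1)},\dots,x_{\sigma(n)})\in X$) and let $f:X\to\{0,1\}$ be symmetric ($f(x_\sigma)=f(x)$ for all $x\in X$, $\sigma\in S_n$). The type $\tau(x)$ of $x\in[M]^n$ is the multiset $\{x_1,\dots,x_n\}$, and the distance $d(S,T)$ between two types is the maximum over $i\in[M]$ of the absolute difference between the multiplicities of $i$ in $S$ and in $T$. Let $$d(f)=\min\{d(\tau(x),\tau(y)) : x,y\in X,\ f(x)\neq f(y)\},\qquad g(f)=\frac{n}{d(f)},$$ with $d(f)=\infty$ and $g(f)=0$ if $f$ is constant. Let $Q(f)$ be the bounded-error quantum query complexity of $f$, that is, the least number of queries $|i,b\rangle\mapsto|i,b+x_i \bmod M\rangle$ made by a quantum algorithm that, for every $x\in X$, outputs $f(x)$ with probability at least $2/3$. Then $$Q(f)\ \ge\ c\,\frac{g(f)^{1/4}}{M}.$$ -/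

import Mathlib

open scoped ENNReal

noncomputable section

namespace QuantumQuery

/-! ### Symmetric partial functions, types, the distance `d(f)` and the measure `g(f)`

Inputs are the words `x : Fin n → Fin M`, the promise is a set `X` of inputs, and a partial
Boolean function with promise `X` is a map `f : X → Bool`. -/

/-- `X` is symmetric: it is closed under permuting the positions of an input. -/
def IsSymmetricPromise {n M : ℕ} (X : Set (Fin n → Fin M)) : Prop :=
  ∀ x ∈ X, ∀ σ : Equiv.Perm (Fin n), x ∘ σ ∈ X

/-- `f` is symmetric: it is invariant under permuting the positions of an input. -/
def IsSymmetricFun {n M : ℕ} {X : Set (Fin n → Fin M)} (f : X → Bool) : Prop :=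
  ∀ (x y : X) (σ : Equiv.Perm (Fin n)), (y : Fin n → Fin M) = (x : Fin n → Fin M) ∘ σ → f y = f x

/-- The type of an input: the multiset of its entries. -/
def inputType {n M : ℕ} (x : Fin n → Fin M) : Multiset (Fin M) :=
  Finset.univ.val.map x

/-- The distance of two types: the largest absolute difference of the multiplicities
of a letter. -/
def typeDist {M : ℕ} (S T : Multiset (Fin M)) : ℕ :=
  Finset.univ.sup fun i : Fin M => ((S.count i : ℤ) - (T.count i : ℤ)).natAbs

/-- `d(f)`: the least distance between the types of two inputs in the promise on which `f` takes
different values (`⊤` if `f` is constant). -/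
def minTypeDist {n M : ℕ} {X : Set (Fin n → Fin M)} (f : X → Bool) : ℕ∞ :=
  ⨅ (x : X) (y : X) (_ : f x ≠ f y), (typeDist (inputType x.1) (inputType y.1) : ℕ∞)

/-- `g(f) = n / d(f)` (equal to `0` if `f` is constant). -/
def gMeasure {n M : ℕ} {X : Set (Fin n → Fin M)} (f : X → Bool) : ℝ≥0∞ :=
  (n : ℝ≥0∞) / (minTypeDist f : ℝ≥0∞)

/-! ### Quantum query algorithms -/

/-- The computational basis: an index register, an answer register and a `w`-dimensional
workspace. The basis state `(i, b, z)` is `|i⟩|b⟩|z⟩`. -/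
abbrev Basis (n M w : ℕ) : Type := Fin n × Fin M × Fin w

/-- The query operator `|i⟩|b⟩|z⟩ ↦ |i⟩|b + x i mod M⟩|z⟩`, acting on amplitude vectors: the new
amplitude of `|i⟩|b⟩|z⟩` is the old amplitude of `|i⟩|b - x i mod M⟩|z⟩`. -/
def oracle {n M w : ℕ} (x : Fin n → Fin M) (ψ : Basis n M w → ℂ) : Basis n M w → ℂ :=
  fun s => ψ (s.1, s.2.1 - x s.1, s.2.2)

/-- A quantum algorithm that makes `T` queries: a workspace of finite dimension, an initial basis
state, the input-independent unitaries `U 0, …, U T`, and the bit to output on each outcome of the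
final measurement in the computational basis. -/
structure Algorithm (n M T : ℕ) where
  w : ℕ
  start : Basis n M w
  U : ℕ → Matrix.unitaryGroup (Basis n M w) ℂ
  output : Basis n M w → Bool

/-- The state `U k · O_x · U (k-1) · ⋯ · O_x · U 0 |start⟩` after `k` queries to the input `x`. -/
def Algorithm.state {n M T : ℕ} (A : Algorithm n M T) (x : Fin n → Fin M) :
    ℕ → (Basis n M A.w → ℂ)
  | 0 => (A.U 0).1.mulVec (Pi.single A.start 1)
  | k + 1 => (A.U (k + 1)).1.mulVec (oracle x (A.state x k))

/-- The probability that the algorithm outputs the bit `b` on input `x`, after its `T` queries. -/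
def Algorithm.prob {n M T : ℕ} (A : Algorithm n M T) (x : Fin n → Fin M) (b : Bool) : ℝ :=
  ∑ s : Basis n M A.w, if A.output s = b then ‖A.state x T s‖ ^ 2 else 0

/-- The algorithm computes `f` with error probability at most `1/3` on each input in the promise. -/
def Algorithm.Computes {n M T : ℕ} (A : Algorithm n M T) {X : Set (Fin n → Fin M)}
    (f : X → Bool) : Prop :=
  ∀ x : X, 2 / 3 ≤ A.prob x.1 (f x)

/-- The bounded-error quantum query complexity `Q(f)`: the least number of queries of a quantum
algorithm that computes `f`. -/
def quantumQueryComplexity {n M : ℕ} {X : Set (Fin n → Fin M)} (f : X → Bool) : ℕ∞ :=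
  ⨅ (T : ℕ) (_ : ∃ A : Algorithm n M T, A.Computes f), (T : ℕ∞)

end QuantumQuery

end

/-!
Let `x`, `y` be inputs with `f x ≠ f y` whose types are at distance `d = d(f)`. These types differ
in `e ≤ M d` letters. Replacing those letters by the most frequent letter `c` of `x` gives an input
`z` in which `c` occurs at least `n / M` and at least `e` times, such that overwriting *any* `e`
occurrences of `c` in `z` suitably gives a permutation of `x`, and also one of `y`.

A run of `T` queries on `z` has total query weight at most `T`, so some `e` occurrences of `c` carry
weight at most `e T M / n`. By the hybrid argument, changing `z` only there moves the final state by
at most `2 √(T · e T M / n)`, while the final states on permutations of `x` and `y` have distance at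
least `1 / 6`. Hence `n ≤ (24 T M)² d`, that is, `g(f) ^ (1/2) ≤ 24 T M`. As `g(f)` is either `0` or
at least `1`, the exponent may be lowered to `1/4`.
-/

namespace QuantumQuery

open Finset

section Merging

variable {α β : Type*}

theorem exists_eqOn_compl_map_val_eq (z : α → β) (D : Finset α) {R : Multiset β}
    (hR : R.card = #D) : ∃ x : α → β, (∀ i ∉ D, x i = z i) ∧ D.val.map x = R := by
  classical
  induction D using Finset.cons_induction generalizing R with
  | empty => exact ⟨z, fun _ _ => rfl, (Multiset.card_eq_zero.1 (by simpa using hR)).symm⟩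
  | cons a D ha ih =>
    obtain ⟨b, hb⟩ := Multiset.card_pos_iff_exists_mem.1 (hR ▸ card_pos.2 (cons_nonempty ha))
    obtain ⟨R, rfl⟩ := Multiset.exists_cons_of_mem hb
    obtain ⟨x, hxz, hxR⟩ := ih (R := R) (by simpa [ha] using hR)
    refine ⟨Function.update x a b, fun i hi => ?_, ?_⟩
    · rw [mem_cons, not_or] at hi
      rw [Function.update_of_ne hi.1, hxz i hi.2]
    · rw [cons_val, Multiset.map_cons, Function.update_self, ← hxR]
      congr 1
      exact Multiset.map_congr rfl fun i hi =>
        Function.update_of_ne (ne_of_mem_of_not_mem hi ha) _ _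

variable [Fintype α]

theorem exists_perm_comp_eq_of_map_univ_val_eq {x z : α → β}
    (h : univ.val.map x = univ.val.map z) : ∃ σ : Equiv.Perm α, x ∘ σ = z := by
  classical
  have card_fiber (b : β) :
      Fintype.card {i // z i = b} = Fintype.card {i // x i = b} := by
    have hb := congrArg (Multiset.count b) h
    simp only [Multiset.count_map, eq_comm (a := b), ← filter_val] at hb
    rw [Fintype.card_subtype, Fintype.card_subtype]
    exact hb.symm
  exact ⟨Equiv.ofFiberEquiv fun b => Fintype.equivOfCardEq (card_fiber b),
    funext fun i => Equiv.ofFiberEquiv_map _ i⟩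

theorem exists_perm_eqOn_compl_of_map_univ_val_eq_add {x z : α → β} {K R : Multiset β} {c : β}
    (hx : univ.val.map x = K + R) (hz : univ.val.map z = K + .replicate R.card c)
    {D : Finset α} (hD : ∀ i ∈ D, z i = c) (hcard : #D = R.card) :
    ∃ σ : Equiv.Perm α, ∀ i ∉ D, x (σ i) = z i := by
  classical
  have split (v : α → β) : univ.val.map v = Dᶜ.val.map v + D.val.map v := by
    rw [← Multiset.map_add, ← disjUnion_val _ _ disjoint_compl_left]
    congr 2
    rw [disjUnion_eq_union, union_comm, union_compl]
  have map_z : D.val.map z = .replicate R.card c := by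
    rw [← hcard]
    exact Multiset.eq_replicate.2 ⟨by simp, by simpa using hD⟩
  have map_z_compl : Dᶜ.val.map z = K := by
    rwa [split z, map_z, add_left_inj] at hz
  obtain ⟨v, hvz, hvR⟩ := exists_eqOn_compl_map_val_eq z D hcard.symm
  have map_v_compl : Dᶜ.val.map v = Dᶜ.val.map z :=
    Multiset.map_congr rfl fun i hi => hvz i (mem_compl.1 hi)
  obtain ⟨σ, hσ⟩ := exists_perm_comp_eq_of_map_univ_val_eq (x := x) (z := v)
    (by rw [hx, split v, map_v_compl, map_z_compl, hvR])
  exact ⟨σ, fun i hi => (congrFun hσ i).trans (hvz i hi)⟩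

theorem card_map_univ_val_sub_comm [DecidableEq β] (x y : α → β) :
    (univ.val.map y - univ.val.map x).card = (univ.val.map x - univ.val.map y).card := by
  have hx := congrArg Multiset.card (Multiset.sub_add_inter (univ.val.map x) (univ.val.map y))
  have hy := congrArg Multiset.card (Multiset.sub_add_inter (univ.val.map y) (univ.val.map x))
  rw [Multiset.inter_comm] at hy
  simp only [Multiset.card_add, Multiset.card_map] at hx hy
  omega

theorem exists_common_modification [DecidableEq β] (x y : α → β) (c : β) :
    ∃ z : α → β, #{i | x i = c} ≤ #{i | z i = c} ∧
      (univ.val.map x - univ.val.map y).card ≤ #{i | z i = c} ∧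
      ∀ D : Finset α, (∀ i ∈ D, z i = c) → #D = (univ.val.map x - univ.val.map y).card →
        ∃ π ρ : Equiv.Perm α, ∀ i ∉ D, x (π i) = z i ∧ y (ρ i) = z i := by
  set S := univ.val.map x with hS
  set T := univ.val.map y
  have hSK : S = S ∩ T + (S - T) := by rw [add_comm, Multiset.sub_add_inter]
  have hTK : T = S ∩ T + (T - S) := by rw [add_comm, Multiset.inter_comm, Multiset.sub_add_inter]
  have hcardS : S.card = (S ∩ T).card + (S - T).card := by
    rw [← Multiset.card_add, ← hSK]
  have hTS : (T - S).card = (S - T).card := card_map_univ_val_sub_comm x y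
  obtain ⟨z, -, hz⟩ := exists_eqOn_compl_map_val_eq x univ
    (R := S ∩ T + .replicate (S - T).card c)
    (by rw [Multiset.card_add, Multiset.card_replicate, ← hcardS, hS, Multiset.card_map, card_def])
  have count_c (v : α → β) : (univ.val.map v).count c = #{i | v i = c} := by
    simp only [Multiset.count_map, eq_comm (a := c), ← filter_val, card_val]
  have hzc : #{i | z i = c} = (S ∩ T).count c + (S - T).card := by
    rw [← count_c, hz, Multiset.count_add, Multiset.count_replicate_self]
  refine ⟨z, ?_, by omega, fun D hD hcard => ?_⟩
  · rw [hzc, ← count_c, ← hS]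
    conv_lhs => rw [hSK, Multiset.count_add]
    exact Nat.add_le_add_left (Multiset.count_le_card _ _) _
  · obtain ⟨π, hπ⟩ := exists_perm_eqOn_compl_of_map_univ_val_eq_add hSK hz hD hcard
    obtain ⟨ρ, hρ⟩ := exists_perm_eqOn_compl_of_map_univ_val_eq_add hTK (by rwa [hTS]) hD
      (hcard.trans hTS.symm)
    exact ⟨π, ρ, fun i hi => ⟨hπ i hi, hρ i hi⟩⟩

end Merging

theorem exists_card_le_card_mul_card_fiber {α β : Type*} [Fintype α] [Fintype β] [Nonempty β]
    [DecidableEq β] (x : α → β) : ∃ c, Fintype.card α ≤ Fintype.card β * #{i | x i = c} := by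
  obtain ⟨c, hc⟩ := Finite.exists_max fun c => #{i | x i = c}
  refine ⟨c, ?_⟩
  rw [mul_comm]
  exact card_le_mul_card_image_of_maps_to (fun _ _ => mem_univ _) _ fun b _ => hc b

theorem exists_subset_card_eq_card_mul_sum_le {α R : Type*} [CommRing R] [LinearOrder R]
    [IsStrictOrderedRing R] (q : α → R) {C : Finset α} {k : ℕ} (hk : k ≤ #C) :
    ∃ D ⊆ C, #D = k ∧ #C * ∑ i ∈ D, q i ≤ k * ∑ i ∈ C, q i := by
  classical
  induction hk using Nat.decreasingInduction with
  | self => exact ⟨C, Subset.rfl, rfl, le_rfl⟩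
  | of_succ k _ ih =>
    obtain ⟨D, hDC, hDk, hD⟩ := ih
    obtain ⟨a, ha, hmax⟩ := D.exists_max_image q (card_pos.1 (by omega))
    refine ⟨D.erase a, (erase_subset _ _).trans hDC, by rw [card_erase_of_mem ha]; omega, ?_⟩
    have herase : ∑ i ∈ D.erase a, q i ≤ k * q a := by
      have := sum_le_card_nsmul (D.erase a) q (q a) fun i hi => hmax i (mem_of_mem_erase hi)
      rwa [card_erase_of_mem ha, hDk, add_tsub_cancel_right, nsmul_eq_mul] at this
    have haverage : (k + 1) * ∑ i ∈ D.erase a, q i ≤ k * ∑ i ∈ D, q i := by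
      rw [← add_sum_erase D q ha]
      linarith
    rw [Nat.cast_succ] at hD
    refine le_of_mul_le_mul_left ?_ (Nat.cast_add_one_pos (α := R) k)
    calc (k + 1) * (#C * ∑ i ∈ D.erase a, q i)
        = #C * ((k + 1) * ∑ i ∈ D.erase a, q i) := by ring
      _ ≤ #C * (k * ∑ i ∈ D, q i) := by gcongr
      _ = k * (#C * ∑ i ∈ D, q i) := by ring
      _ ≤ k * ((k + 1) * ∑ i ∈ C, q i) := by gcongr
      _ = (k + 1) * (k * ∑ i ∈ C, q i) := by ring

theorem dist_le_sum_dist_of_lipschitzWith_one {E : Type*} [PseudoMetricSpace E]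
    {F G : ℕ → E → E} {u v : ℕ → E} (hF : ∀ k, LipschitzWith 1 (F k)) (h₀ : u 0 = v 0)
    (hu : ∀ k, u (k + 1) = F k (u k)) (hv : ∀ k, v (k + 1) = G k (v k)) (k : ℕ) :
    dist (u k) (v k) ≤ ∑ j ∈ range k, dist (F j (v j)) (G j (v j)) := by
  induction k with
  | zero => simp [h₀]
  | succ k ih =>
    rw [hu, hv, sum_range_succ]
    calc dist (F k (u k)) (G k (v k))
        ≤ dist (F k (u k)) (F k (v k)) + dist (F k (v k)) (G k (v k)) := dist_triangle _ _ _
      _ ≤ dist (u k) (v k) + dist (F k (v k)) (G k (v k)) := by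
        gcongr
        simpa using (hF k).dist_le_mul (u k) (v k)
      _ ≤ _ := by gcongr

section CoordProj

variable {𝕜 ι : Type*} [RCLike 𝕜] [DecidableEq ι]

/-- The orthogonal projection of `𝕜^ι` onto the span of the basis vectors indexed by `B`. -/
noncomputable def coordProj (B : Finset ι) : EuclideanSpace 𝕜 ι →ₗ[𝕜] EuclideanSpace 𝕜 ι where
  toFun ψ := WithLp.toLp 2 fun s => if s ∈ B then ψ s else 0
  map_add' φ ψ := by ext s; by_cases hs : s ∈ B <;> simp [hs]
  map_smul' a ψ := by ext s; by_cases hs : s ∈ B <;> simp [hs]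

theorem coordProj_apply (B : Finset ι) (ψ : EuclideanSpace 𝕜 ι) (s : ι) :
    coordProj B ψ s = if s ∈ B then ψ s else 0 := rfl

variable [Fintype ι]

theorem norm_coordProj_sq (B : Finset ι) (ψ : EuclideanSpace 𝕜 ι) :
    ‖coordProj B ψ‖ ^ 2 = ∑ s ∈ B, ‖ψ s‖ ^ 2 := by
  simp [EuclideanSpace.norm_sq_eq, coordProj_apply, apply_ite, sum_ite_mem]

theorem norm_coordProj_le (B : Finset ι) (ψ : EuclideanSpace 𝕜 ι) : ‖coordProj B ψ‖ ≤ ‖ψ‖ := by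
  refine le_of_sq_le_sq ?_ (norm_nonneg ψ)
  rw [norm_coordProj_sq, EuclideanSpace.norm_sq_eq]
  exact sum_le_univ_sum_of_nonneg fun s => sq_nonneg _

theorem norm_coordProj_sq_sub_le (B : Finset ι) (φ ψ : EuclideanSpace 𝕜 ι) :
    ‖coordProj B φ‖ ^ 2 - ‖coordProj B ψ‖ ^ 2 ≤ (‖φ‖ + ‖ψ‖) * ‖φ - ψ‖ := by
  have hsub : ‖coordProj B φ‖ - ‖coordProj B ψ‖ ≤ ‖φ - ψ‖ :=
    (norm_sub_norm_le _ _).trans (by rw [← map_sub]; exact norm_coordProj_le B (φ - ψ))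
  calc ‖coordProj B φ‖ ^ 2 - ‖coordProj B ψ‖ ^ 2
      = (‖coordProj B φ‖ + ‖coordProj B ψ‖) * (‖coordProj B φ‖ - ‖coordProj B ψ‖) := sq_sub_sq _ _
    _ ≤ (‖coordProj B φ‖ + ‖coordProj B ψ‖) * ‖φ - ψ‖ := by gcongr
    _ ≤ (‖φ‖ + ‖ψ‖) * ‖φ - ψ‖ := by gcongr <;> exact norm_coordProj_le B _

end CoordProj

section Hybrid

variable {n M w : ℕ}

/-- The permutation `(i, b, z) ↦ (i, b + x i, z)` of the computational basis that underlies
`oracle x`. -/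
def oraclePerm (x : Fin n → Fin M) : Equiv.Perm (Basis n M w) where
  toFun s := (s.1, s.2.1 + x s.1, s.2.2)
  invFun s := (s.1, s.2.1 - x s.1, s.2.2)
  left_inv s := by
    have : NeZero M := ⟨by rintro rfl; exact s.2.1.elim0⟩
    simp
  right_inv s := by
    have : NeZero M := ⟨by rintro rfl; exact s.2.1.elim0⟩
    simp

/-- The query operator `oracle x` as a unitary operator for the Euclidean norm. -/
noncomputable def oracleIsometry (x : Fin n → Fin M) :
    EuclideanSpace ℂ (Basis n M w) ≃ₗᵢ[ℂ] EuclideanSpace ℂ (Basis n M w) :=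
  LinearIsometryEquiv.piLpCongrLeft 2 ℂ ℂ (oraclePerm x)

theorem oracleIsometry_apply (x : Fin n → Fin M) (ψ : EuclideanSpace ℂ (Basis n M w))
    (s : Basis n M w) : oracleIsometry x ψ s = ψ (s.1, s.2.1 - x s.1, s.2.2) := rfl

theorem dist_oracleIsometry_le {x z : Fin n → Fin M} {D : Finset (Fin n)}
    (h : ∀ i ∉ D, x i = z i) (ψ : EuclideanSpace ℂ (Basis n M w)) :
    dist (oracleIsometry x ψ) (oracleIsometry z ψ) ≤ 2 * ‖coordProj (D ×ˢ univ) ψ‖ := by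
  set φ := coordProj (D ×ˢ univ) ψ with hφ
  have hproj : oracleIsometry x ψ - oracleIsometry z ψ =
      oracleIsometry x φ - oracleIsometry z φ := by
    ext s
    by_cases hs : s.1 ∈ D <;>
      simp [hφ, oracleIsometry_apply, coordProj_apply, hs, h]
  calc dist (oracleIsometry x ψ) (oracleIsometry z ψ)
      ≤ ‖oracleIsometry x φ‖ + ‖oracleIsometry z φ‖ := by
        rw [dist_eq_norm, hproj]
        exact norm_sub_le _ _
    _ = 2 * ‖φ‖ := by rw [LinearIsometryEquiv.norm_map, LinearIsometryEquiv.norm_map, two_mul]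

namespace Algorithm

variable {T : ℕ} (A : Algorithm n M T)

/-- The unitary `U k` of the algorithm as an isometry for the Euclidean norm. -/
noncomputable def unitaryIsometry (k : ℕ) :
    EuclideanSpace ℂ (Basis n M A.w) ≃ₗᵢ[ℂ] EuclideanSpace ℂ (Basis n M A.w) :=
  Unitary.linearIsometryEquiv
    ⟨Matrix.toEuclideanCLM (n := Basis n M A.w) (𝕜 := ℂ) (A.U k).1, Unitary.map_mem _ (A.U k).2⟩

/-- The state after `k` queries as a vector of the Euclidean space, whose norm the bare function
type of `Algorithm.state` lacks. -/
noncomputable def stateVec (x : Fin n → Fin M) (k : ℕ) : EuclideanSpace ℂ (Basis n M A.w) :=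
  WithLp.toLp 2 (A.state x k)

theorem stateVec_zero (x : Fin n → Fin M) :
    A.stateVec x 0 = A.unitaryIsometry 0 (EuclideanSpace.single A.start 1) := rfl

theorem stateVec_succ (x : Fin n → Fin M) (k : ℕ) :
    A.stateVec x (k + 1) = A.unitaryIsometry (k + 1) (oracleIsometry x (A.stateVec x k)) := rfl

theorem norm_stateVec (x : Fin n → Fin M) (k : ℕ) : ‖A.stateVec x k‖ = 1 := by
  induction k with
  | zero => simp [stateVec_zero]
  | succ k ih => rw [stateVec_succ, LinearIsometryEquiv.norm_map, LinearIsometryEquiv.norm_map, ih]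

/-- The total probability weight that the `T` queries on input `z` put on position `i`. -/
noncomputable def queryWeight (z : Fin n → Fin M) (i : Fin n) : ℝ :=
  ∑ j ∈ range T, ∑ p, ‖A.stateVec z j (i, p)‖ ^ 2

theorem sum_queryWeight (z : Fin n → Fin M) (D : Finset (Fin n)) :
    ∑ i ∈ D, A.queryWeight z i =
      ∑ j ∈ range T, ‖coordProj (D ×ˢ univ) (A.stateVec z j)‖ ^ 2 := by
  simp only [queryWeight, norm_coordProj_sq, sum_product]
  exact sum_comm

theorem sum_queryWeight_le (z : Fin n → Fin M) (D : Finset (Fin n)) :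
    ∑ i ∈ D, A.queryWeight z i ≤ T := by
  rw [sum_queryWeight]
  calc ∑ j ∈ range T, ‖coordProj (D ×ˢ univ) (A.stateVec z j)‖ ^ 2
      ≤ ∑ j ∈ range T, ‖A.stateVec z j‖ ^ 2 := by gcongr; exact norm_coordProj_le _ _
    _ = T := by simp [norm_stateVec]

theorem dist_stateVec_le (x z : Fin n → Fin M) (k : ℕ) :
    dist (A.stateVec x k) (A.stateVec z k) ≤
      ∑ j ∈ range k,
        dist (oracleIsometry x (A.stateVec z j)) (oracleIsometry z (A.stateVec z j)) := by
  simpa only [LinearIsometryEquiv.dist_map] using dist_le_sum_dist_of_lipschitzWith_one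
    (F := fun j ψ => A.unitaryIsometry (j + 1) (oracleIsometry x ψ))
    (G := fun j ψ => A.unitaryIsometry (j + 1) (oracleIsometry z ψ))
    (fun j => ((A.unitaryIsometry (j + 1)).isometry.comp (oracleIsometry x).isometry).lipschitz)
    ((A.stateVec_zero x).trans (A.stateVec_zero z).symm) (A.stateVec_succ x) (A.stateVec_succ z) k

theorem dist_stateVec_sq_le {x z : Fin n → Fin M} {D : Finset (Fin n)}
    (h : ∀ i ∉ D, x i = z i) :
    dist (A.stateVec x T) (A.stateVec z T) ^ 2 ≤ 4 * T * ∑ i ∈ D, A.queryWeight z i := by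
  calc dist (A.stateVec x T) (A.stateVec z T) ^ 2
      ≤ (∑ j ∈ range T, 2 * ‖coordProj (D ×ˢ univ) (A.stateVec z j)‖) ^ 2 := by
        gcongr
        refine (A.dist_stateVec_le x z T).trans ?_
        gcongr
        exact dist_oracleIsometry_le h _
    _ ≤ (T : ℝ) * ∑ j ∈ range T, (2 * ‖coordProj (D ×ˢ univ) (A.stateVec z j)‖) ^ 2 := by
        simpa only [card_range] using sq_sum_le_card_mul_sum_sq (s := range T)
          (f := fun j => 2 * ‖coordProj (D ×ˢ univ) (A.stateVec z j)‖)
    _ = 4 * T * ∑ i ∈ D, A.queryWeight z i := by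
        simp only [sum_queryWeight, mul_pow, ← mul_sum]
        ring

theorem prob_eq_norm_coordProj_sq (x : Fin n → Fin M) (b : Bool) :
    A.prob x b = ‖coordProj {s | A.output s = b} (A.stateVec x T)‖ ^ 2 := by
  rw [norm_coordProj_sq, sum_filter]
  rfl

theorem prob_add_prob_not (x : Fin n → Fin M) (b : Bool) : A.prob x b + A.prob x (!b) = 1 := by
  rw [← one_pow 2, ← A.norm_stateVec x T, EuclideanSpace.norm_sq_eq]
  unfold prob
  rw [← sum_add_distrib]
  refine sum_congr rfl fun s _ => ?_
  cases A.output s <;> cases b <;> simp [stateVec]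

theorem prob_sub_prob_le (x y : Fin n → Fin M) (b : Bool) :
    A.prob x b - A.prob y b ≤ 2 * dist (A.stateVec x T) (A.stateVec y T) := by
  rw [prob_eq_norm_coordProj_sq, prob_eq_norm_coordProj_sq, dist_eq_norm]
  refine (norm_coordProj_sq_sub_le _ _ _).trans_eq ?_
  rw [norm_stateVec, norm_stateVec, one_add_one_eq_two]

theorem one_sixth_le_dist_stateVec {x y : Fin n → Fin M} {b : Bool}
    (hx : 2 / 3 ≤ A.prob x b) (hy : 2 / 3 ≤ A.prob y (!b)) :
    1 / 6 ≤ dist (A.stateVec x T) (A.stateVec y T) := by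
  linarith [A.prob_sub_prob_le x y b, A.prob_add_prob_not y b]

theorem exists_perm_card_mul_dist_sq_le (x y : Fin n → Fin M) (c : Fin M) :
    ∃ π ρ : Equiv.Perm (Fin n),
      #{i | x i = c} * dist (A.stateVec (x ∘ π) T) (A.stateVec (y ∘ ρ) T) ^ 2 ≤
        16 * T ^ 2 * (inputType x - inputType y).card := by
  obtain ⟨z, hxC, heC, hz⟩ := exists_common_modification x y c
  set C : Finset (Fin n) := {i | z i = c}
  obtain ⟨D, hDC, hDe, hDle⟩ := exists_subset_card_eq_card_mul_sum_le (A.queryWeight z) heC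
  obtain ⟨π, ρ, h⟩ := hz D (fun i hi => (mem_filter.1 (hDC hi)).2) hDe
  refine ⟨π, ρ, ?_⟩
  set W := ∑ i ∈ D, A.queryWeight z i
  have hx : dist (A.stateVec (x ∘ π) T) (A.stateVec z T) ^ 2 ≤ 4 * T * W :=
    A.dist_stateVec_sq_le fun i hi => (h i hi).1
  have hy : dist (A.stateVec (y ∘ ρ) T) (A.stateVec z T) ^ 2 ≤ 4 * T * W :=
    A.dist_stateVec_sq_le fun i hi => (h i hi).2
  calc #{i | x i = c} * dist (A.stateVec (x ∘ π) T) (A.stateVec (y ∘ ρ) T) ^ 2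
      ≤ #C * (dist (A.stateVec (x ∘ π) T) (A.stateVec z T) +
          dist (A.stateVec (y ∘ ρ) T) (A.stateVec z T)) ^ 2 := by
        gcongr
        exact dist_triangle_right _ _ _
    _ ≤ #C * (2 * (dist (A.stateVec (x ∘ π) T) (A.stateVec z T) ^ 2 +
          dist (A.stateVec (y ∘ ρ) T) (A.stateVec z T) ^ 2)) := by
        gcongr
        exact add_sq_le
    _ ≤ #C * (2 * (4 * T * W + 4 * T * W)) := by gcongr
    _ = 16 * T * (#C * W) := by ring
    _ ≤ 16 * T * ((inputType x - inputType y).card * T) := by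
        gcongr 16 * T * ?_
        exact hDle.trans (mul_le_mul_of_nonneg_left (A.sum_queryWeight_le z C) (Nat.cast_nonneg _))
    _ = 16 * T ^ 2 * (inputType x - inputType y).card := by ring

end Algorithm

end Hybrid

section LowerBound

variable {n M : ℕ} {X : Set (Fin n → Fin M)} {f : X → Bool}

theorem card_sub_le_mul_typeDist (S T : Multiset (Fin M)) :
    (S - T).card ≤ M * typeDist S T := by
  calc (S - T).card = ∑ a, (S - T).count a := (Multiset.sum_count_eq_card (by simp)).symm
    _ ≤ ∑ _a : Fin M, typeDist S T := by
        gcongr with a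
        have h : ((S.count a : ℤ) - (T.count a : ℤ)).natAbs ≤ typeDist S T :=
          le_sup (f := fun i => ((S.count i : ℤ) - (T.count i : ℤ)).natAbs) (mem_univ a)
        rw [Multiset.count_sub]
        omega
    _ = M * typeDist S T := by simp

theorem typeDist_inputType_le (x y : Fin n → Fin M) :
    typeDist (inputType x) (inputType y) ≤ n := by
  have count_le (v : Fin n → Fin M) (a : Fin M) : (inputType v).count a ≤ n := by
    simpa [inputType] using Multiset.count_le_card a (inputType v)
  refine Finset.sup_le fun a _ => ?_
  have hx := count_le x a
  have hy := count_le y a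
  omega

theorem Algorithm.Computes.le_sq_mul_typeDist {T : ℕ} {A : Algorithm n M T} (hA : A.Computes f)
    (hX : IsSymmetricPromise X) (hf : IsSymmetricFun f) {x y : X} (hxy : f x ≠ f y) :
    n ≤ (24 * T * M) ^ 2 * typeDist (inputType x.1) (inputType y.1) := by
  rcases n.eq_zero_or_pos with rfl | hn
  · exact Nat.zero_le _
  have : Nonempty (Fin M) := ⟨x.1 ⟨0, hn⟩⟩
  obtain ⟨c, hc⟩ := exists_card_le_card_mul_card_fiber x.1
  obtain ⟨π, ρ, hclose⟩ := A.exists_perm_card_mul_dist_sq_le x.1 y.1 c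
  have hx := hA ⟨x.1 ∘ π, hX x.1 x.2 π⟩
  have hy := hA ⟨y.1 ∘ ρ, hX y.1 y.2 ρ⟩
  rw [hf x _ π rfl] at hx
  rw [hf y _ ρ rfl, ← Bool.not_eq.2 hxy] at hy
  have hfar := A.one_sixth_le_dist_stateVec hx hy
  have htypes : ((inputType x.1 - inputType y.1).card : ℝ) ≤
      M * typeDist (inputType x.1) (inputType y.1) :=
    mod_cast card_sub_le_mul_typeDist _ _
  set d := typeDist (inputType x.1) (inputType y.1)
  have hfiber : #{i | x.1 i = c} * (1 / 6 : ℝ) ^ 2 ≤ 16 * T ^ 2 * (M * d) := by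
    refine (hclose.trans' ?_).trans ?_ <;> gcongr
  have key : (n : ℝ) ≤ (24 * T * M) ^ 2 * d := by
    calc (n : ℝ) ≤ M * #{i | x.1 i = c} := mod_cast by simpa using hc
      _ = 36 * M * (#{i | x.1 i = c} * (1 / 6) ^ 2) := by ring
      _ ≤ 36 * M * (16 * T ^ 2 * (M * d)) := by gcongr
      _ = (24 * T * M) ^ 2 * d := by ring
  exact_mod_cast key

theorem exists_minTypeDist_eq (h : minTypeDist f ≠ ⊤) :
    ∃ x y : X, f x ≠ f y ∧ minTypeDist f = typeDist (inputType x.1) (inputType y.1) := by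
  have hpairs : minTypeDist f = ⨅ p : {p : X × X // f p.1 ≠ f p.2},
      (typeDist (inputType p.1.1.1) (inputType p.1.2.1) : ℕ∞) := by
    simp only [minTypeDist, iInf_subtype, iInf_prod]
  have : Nonempty {p : X × X // f p.1 ≠ f p.2} := by
    by_contra hempty
    rw [not_nonempty_iff] at hempty
    exact h (hpairs.trans (iInf_of_empty _))
  obtain ⟨⟨⟨x, y⟩, hxy⟩, hmin⟩ := ENat.exists_eq_iInf
    fun p : {p : X × X // f p.1 ≠ f p.2} =>
      (typeDist (inputType p.1.1.1) (inputType p.1.2.1) : ℕ∞)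
  exact ⟨x, y, hxy, hpairs.trans hmin.symm⟩

theorem gMeasure_eq_zero_or_exists_eq_div (f : X → Bool) :
    gMeasure f = 0 ∨
      ∃ x y : X, f x ≠ f y ∧ gMeasure f = n / typeDist (inputType x.1) (inputType y.1) := by
  by_cases h : minTypeDist f = ⊤
  · exact Or.inl (by simp [gMeasure, h])
  · obtain ⟨x, y, hxy, hmin⟩ := exists_minTypeDist_eq h
    exact Or.inr ⟨x, y, hxy, by rw [gMeasure, hmin, ENat.toENNReal_coe]⟩

theorem Algorithm.Computes.gMeasure_le {T : ℕ} {A : Algorithm n M T} (hA : A.Computes f)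
    (hX : IsSymmetricPromise X) (hf : IsSymmetricFun f) :
    gMeasure f ≤ (24 * T * M) ^ 2 := by
  obtain hg | ⟨x, y, hxy, hg⟩ := gMeasure_eq_zero_or_exists_eq_div f
  · simp [hg]
  · rw [hg]
    exact ENNReal.div_le_of_le_mul (mod_cast hA.le_sq_mul_typeDist hX hf hxy)

theorem gMeasure_eq_zero_or_one_le (f : X → Bool) : gMeasure f = 0 ∨ 1 ≤ gMeasure f := by
  obtain hg | ⟨x, y, -, hg⟩ := gMeasure_eq_zero_or_exists_eq_div f
  · exact Or.inl hg
  rcases n.eq_zero_or_pos with rfl | hn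
  · exact Or.inl (by simp [hg])
  · rw [hg, ENNReal.le_div_iff_mul_le (Or.inr (mod_cast hn.ne')) (by simp), one_mul]
    exact Or.inr (mod_cast typeDist_inputType_le x.1 y.1)

theorem gMeasure_rpow_le_rpow (f : X → Bool) {p q : ℝ} (hp : 0 < p) (hpq : p ≤ q) :
    gMeasure f ^ p ≤ gMeasure f ^ q := by
  obtain hg | hg := gMeasure_eq_zero_or_one_le f
  · simp [hg, ENNReal.zero_rpow_of_pos hp]
  · exact ENNReal.rpow_le_rpow_of_exponent_le hg hpq

end LowerBound

end QuantumQuery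

open QuantumQuery in
theorem mainTheorem4_general :
    ∃ c : ℝ, 0 < c ∧
      ∀ (n M : ℕ) (X : Set (Fin n → Fin M)) (f : X → Bool),
        IsSymmetricPromise X → IsSymmetricFun f →
          ENNReal.ofReal c * (gMeasure f ^ (1 / 2 : ℝ) / (M : ℝ≥0∞)) ≤
            (quantumQueryComplexity f : ℝ≥0∞) := by
  refine ⟨1 / 24, by norm_num, fun n M X f hX hf => ?_⟩
  simp only [quantumQueryComplexity, ENat.toENNReal_iInf, ENat.toENNReal_coe]
  refine le_iInf₂ fun T ⟨A, hA⟩ => ?_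
  have hsqrt : gMeasure f ^ (1 / 2 : ℝ) ≤ 24 * T * M := by
    rw [one_div, ENNReal.rpow_inv_le_iff two_pos, ENNReal.rpow_two]
    exact hA.gMeasure_le hX hf
  calc ENNReal.ofReal (1 / 24) * (gMeasure f ^ (1 / 2 : ℝ) / M)
      ≤ ENNReal.ofReal (1 / 24) * (24 * T) := by
        gcongr
        exact ENNReal.div_le_of_le_mul hsqrt
    _ = T := by
        rw [← mul_assoc, one_div, ENNReal.ofReal_inv_of_pos (by norm_num), ENNReal.ofReal_ofNat,
          ENNReal.inv_mul_cancel (by norm_num) (by norm_num), one_mul]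

theorem mainTheorem4 :
    ∃ c : ℝ, 0 < c ∧
      ∀ (n M : ℕ) (X : Set (Fin n → Fin M)) (f : X → Bool),
        QuantumQuery.IsSymmetricPromise X → QuantumQuery.IsSymmetricFun f →
          ENNReal.ofReal c * (QuantumQuery.gMeasure f ^ (1 / 4 : ℝ) / (M : ℝ≥0∞)) ≤
            (QuantumQuery.quantumQueryComplexity f : ℝ≥0∞) := by
  obtain ⟨c, hc, h⟩ := mainTheorem4_general
  refine ⟨c, hc, fun n M X f hX hf => (h n M X f hX hf).trans' ?_⟩
  have := QuantumQuery.gMeasure_rpow_le_rpow f (p := 1 / 4) (q := 1 / 2) (by norm_num) (by norm_num)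
  gcongr
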